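/- Let $(X,\mathcal B,\mu)$ be a standard (Lebesgue) probability space and let $\mathrm{Aut}(\mu)$ be the group of invertible $\mu$-preserving transformations of $X$, identified when they agree almost everywhere. For a sequence $\{A_i\}_{i\ge 1}$ of measurable sets that is dense in $\mathcal B$ (for every $B\in\mathcal B$ and $\varepsilon>0$ some $\mu(A_i\triangle B)<\varepsilon$), the Halmos metric is $$\rho(S,T)=\sum_{i\ge 1}2^{-i}\bigl(\mu(SA_i\triangle TA_i)+\mu(S^{-1}A_i\triangle T^{-1}A_i)\bigr).$$ Fix such a sequence for $\mu$ and one for $\mu\otimes\mu$; this gives Halmos metrics on $\mathrm{Aut}(\mu)$ (denoted $\rho$) and on $\mathrm{Aut}(\mu\otimes\mu)$. For $S\in\mathrm{Aut}(\mu)$ let $\mathrm{Ext}(S)\subset\mathrm{Aut}(\mu\otimes\mu)$ be the set of all skew products over $S$, $$R(x,y)=(Sx,T_xy)\quad\text{for a.e. }(x,y),$$ where $\{T_x\}_{x\in X}$ is a measurable family in $\mathrm{Aut}(\mu)$, with the topology induced by the Halmos metric of $\mathrm{Aut}(\mu\otimes\mu)$. For such $R$ put $C(x,n,R)=T_{S^{n-1}x}\cdots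 T_{Sx}T_x$. For a measurable set $A\subset X$ and integers $m\ge1$, $n\ge 0$ let $$D(m,n,R,A)=\{x\in A:\rho(C(x,n,R),\mathrm{Id})<1/m\},$$ $$\mathrm{Rec}(S,A)=\{R\in\mathrm{Ext}(S): \forall m\ge 1\ \forall N\ge 0\ \exists n>N\ \ \mu(D(m,n,R,A))>0\}.$$ **Theorem 2.** Let $S\in\mathrm{Aut}(\mu)$ be aperiodic, i.e. for a.e. $x$ one has $S^nx\ne x$ for all $n\ge1$, and let $A\subset X$ be a measurable set with $\mu(A)>0$. Then the class $\mathrm{Rec}(S,A)$ of extensions recurrent on $A$ contains a dense $G_\delta$ subset of $\mathrm{Ext}(S)$. -/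

import Mathlib

open MeasureTheory Filter
open scoped symmDiff

namespace SkewRec

section Automorphisms

/-- The bimeasurable bijections of `X` that preserve `μ`, as a group under composition. -/
def mpPerm {X : Type*} [MeasurableSpace X] (μ : Measure X) : Subgroup (Equiv.Perm X) where
  carrier := {e | MeasurePreserving (⇑e) μ μ ∧ MeasurePreserving (⇑e.symm) μ μ}
  mul_mem' ha hb := ⟨ha.1.comp hb.1, hb.2.comp ha.2⟩
  one_mem' := ⟨MeasurePreserving.id μ, MeasurePreserving.id μ⟩
  inv_mem' {_} ha := ⟨ha.2, ha.1⟩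

/-- The normal subgroup of those transformations that are a.e. equal to the identity. -/
def nullPerm {X : Type*} [MeasurableSpace X] (μ : Measure X) : Subgroup (mpPerm μ) where
  carrier := {e | ∀ᵐ x ∂μ, (e : Equiv.Perm X) x = x}
  mul_mem' {a b} ha hb := by
    filter_upwards [hb, b.2.1.quasiMeasurePreserving.ae ha] with x h1 h2
    exact h2.trans h1
  one_mem' := by
    change ∀ᵐ x ∂μ, x = x
    simp
  inv_mem' {a} ha := by
    filter_upwards [a.2.2.quasiMeasurePreserving.ae ha] with x hx
    simpa using hx.symm

instance nullPerm_normal {X : Type*} [MeasurableSpace X] (μ : Measure X) :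
    (nullPerm μ).Normal where
  conj_mem n hn g := by
    change ∀ᵐ x ∂μ, (g : Equiv.Perm X) ((n : Equiv.Perm X) ((g : Equiv.Perm X).symm x)) = x
    filter_upwards [g.2.2.quasiMeasurePreserving.ae hn] with x hx
    rw [hx]
    simp

/-- `Aut(μ)`: the group of automorphisms of the measure space `(X, μ)`, two automorphisms being
identified if they agree a.e.  The product is composition, `(S * T) x = S (T x)`. -/
abbrev MeasAut {X : Type*} [MeasurableSpace X] (μ : Measure X) : Type _ :=
  mpPerm μ ⧸ nullPerm μ

/-- A pointwise representative of an automorphism (well defined up to a.e. equality). -/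
noncomputable def MeasAut.toPerm {X : Type*} [MeasurableSpace X] {μ : Measure X}
    (S : MeasAut μ) : Equiv.Perm X :=
  (Quotient.out S : mpPerm μ)

theorem MeasAut.toPerm_mem {X : Type*} [MeasurableSpace X] {μ : Measure X}
    (S : MeasAut μ) : S.toPerm ∈ mpPerm μ :=
  (Quotient.out S : mpPerm μ).2

/-- Automorphisms are determined by the a.e. class of their representatives. -/
theorem MeasAut.ext_ae {X : Type*} [MeasurableSpace X] {μ : Measure X} {S T : MeasAut μ}
    (h : ∀ᵐ x ∂μ, S.toPerm x = T.toPerm x) : S = T := by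
  rw [← QuotientGroup.out_eq' S, ← QuotientGroup.out_eq' T, QuotientGroup.eq]
  change ∀ᵐ x ∂μ, S.toPerm.symm (T.toPerm x) = x
  filter_upwards [h] with x hx
  rw [← hx, Equiv.symm_apply_apply]

/-- `toPerm` really is a representative: it agrees a.e. with any transformation of the class. -/
theorem MeasAut.toPerm_mk {X : Type*} [MeasurableSpace X] {μ : Measure X} (e : mpPerm μ) :
    ∀ᵐ x ∂μ, MeasAut.toPerm (QuotientGroup.mk e : MeasAut μ) x = (e : Equiv.Perm X) x := by
  have h : (QuotientGroup.mk e : MeasAut μ) = QuotientGroup.mk (Quotient.out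
      (QuotientGroup.mk e : MeasAut μ)) := (QuotientGroup.out_eq' _).symm
  rw [QuotientGroup.eq] at h
  have h' : ∀ᵐ x ∂μ, (e : Equiv.Perm X).symm
      (MeasAut.toPerm (QuotientGroup.mk e : MeasAut μ) x) = x := h
  filter_upwards [h'] with x hx
  rw [Equiv.symm_apply_eq] at hx
  exact hx

/-- `S` is aperiodic: almost every point is not periodic. -/
def MeasAut.Aperiodic {X : Type*} [MeasurableSpace X] {μ : Measure X} (S : MeasAut μ) : Prop :=
  ∀ᵐ x ∂μ, ∀ n : ℕ, 1 ≤ n → (⇑S.toPerm)^[n] x ≠ x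

end Automorphisms

section Halmos

/-- A sequence of measurable sets that is dense in the measure algebra of `μ`. -/
structure DenseFamily {X : Type*} [MeasurableSpace X] (μ : Measure X) where
  sets : ℕ → Set X
  dense : μ.MeasureDense (Set.range sets)

theorem DenseFamily.measurable {X : Type*} [MeasurableSpace X] {μ : Measure X}
    (𝒜 : DenseFamily μ) (i : ℕ) : MeasurableSet (𝒜.sets i) :=
  𝒜.dense.measurable _ ⟨i, rfl⟩

/-- The Halmos metric
`ρ(S, T) = ∑ 2^{-i} (μ(S Aᵢ ∆ T Aᵢ) + μ(S⁻¹ Aᵢ ∆ T⁻¹ Aᵢ))`, `i = 1, 2, …`,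
of a dense family of sets (enumerated by `i = 0, 1, …` in the code). -/
noncomputable def halmosDist {X : Type*} [MeasurableSpace X] {μ : Measure X}
    (𝒜 : DenseFamily μ) (S T : MeasAut μ) : ℝ :=
  ∑' i : ℕ, (1 / 2 : ℝ) ^ (i + 1) *
    (μ.real ((S.toPerm '' 𝒜.sets i) ∆ (T.toPerm '' 𝒜.sets i)) +
      μ.real (((S⁻¹).toPerm '' 𝒜.sets i) ∆ ((T⁻¹).toPerm '' 𝒜.sets i)))

theorem summable_halmos {X : Type*} [MeasurableSpace X] {μ : Measure X} [IsProbabilityMeasure μ]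
    (𝒜 : DenseFamily μ) (S T : MeasAut μ) :
    Summable fun i : ℕ => (1 / 2 : ℝ) ^ (i + 1) *
      (μ.real ((S.toPerm '' 𝒜.sets i) ∆ (T.toPerm '' 𝒜.sets i)) +
        μ.real (((S⁻¹).toPerm '' 𝒜.sets i) ∆ ((T⁻¹).toPerm '' 𝒜.sets i))) := by
  refine Summable.of_nonneg_of_le (fun i => by positivity) (fun i => ?_)
    (summable_geometric_two)
  have h1 : μ.real ((S.toPerm '' 𝒜.sets i) ∆ (T.toPerm '' 𝒜.sets i)) ≤ 1 := measureReal_le_one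
  have h2 : μ.real (((S⁻¹).toPerm '' 𝒜.sets i) ∆ ((T⁻¹).toPerm '' 𝒜.sets i)) ≤ 1 :=
    measureReal_le_one
  have h3 : (0 : ℝ) < (1 / 2) ^ i := by positivity
  rw [pow_succ]
  nlinarith

theorem eq_of_halmosDist_eq_zero {X : Type*} [MeasurableSpace X] [StandardBorelSpace X]
    {μ : Measure X} [IsProbabilityMeasure μ] (𝒜 : DenseFamily μ) (S T : MeasAut μ)
    (h : halmosDist 𝒜 S T = 0) : S = T := by
  have hs := (summable_halmos 𝒜 S T).hasSum
  rw [show (∑' i : ℕ, _) = (0 : ℝ) from h] at hs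
  have hz := (hasSum_zero_iff_of_nonneg (fun i => by
    change (0 : ℝ) ≤ _
    positivity)).1 hs
  have hi : ∀ i, μ.real ((S.toPerm '' 𝒜.sets i) ∆ (T.toPerm '' 𝒜.sets i)) = 0 := by
    intro i
    have := congrFun hz i
    simp only [Pi.zero_apply, mul_eq_zero] at this
    rcases this with h0 | h0
    · exact absurd h0 (by positivity)
    · have a1 : 0 ≤ μ.real ((S.toPerm '' 𝒜.sets i) ∆ (T.toPerm '' 𝒜.sets i)) := by positivity
      have a2 : 0 ≤ μ.real (((S⁻¹).toPerm '' 𝒜.sets i) ∆ ((T⁻¹).toPerm '' 𝒜.sets i)) := by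
        positivity
      linarith
  have himg : ∀ (R : MeasAut μ) (B C : Set X), MeasurableSet B → MeasurableSet C →
      μ.real ((R.toPerm '' B) ∆ (R.toPerm '' C)) = μ.real (B ∆ C) := by
    intro R B C hB hC
    rw [← Set.image_symmDiff R.toPerm.injective, Equiv.image_eq_preimage_symm]
    exact R.toPerm_mem.2.measureReal_preimage (hB.symmDiff hC).nullMeasurableSet
  have hall : ∀ B, MeasurableSet B → μ ((S.toPerm '' B) ∆ (T.toPerm '' B)) = 0 := by
    intro B hB
    have hle : μ.real ((S.toPerm '' B) ∆ (T.toPerm '' B)) ≤ 0 := by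
      refine le_of_forall_pos_le_add fun ε hε => ?_
      obtain ⟨_, ⟨i, rfl⟩, hi''⟩ := 𝒜.dense.approx B hB (measure_ne_top μ B) (ε / 2) (by positivity)
      have hi' : μ.real (B ∆ 𝒜.sets i) < ε / 2 :=
        (ENNReal.lt_ofReal_iff_toReal_lt (measure_ne_top μ _)).1 hi''
      have t1 := measureReal_symmDiff_le (μ := μ) (s := S.toPerm '' B)
        (t := S.toPerm '' 𝒜.sets i) (T.toPerm '' B)
      have t2 := measureReal_symmDiff_le (μ := μ) (s := S.toPerm '' 𝒜.sets i)
        (t := T.toPerm '' 𝒜.sets i) (T.toPerm '' B)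
      rw [himg S _ _ hB (𝒜.measurable i)] at t1
      rw [himg T _ _ (𝒜.measurable i) hB, hi i, symmDiff_comm (𝒜.sets i)] at t2
      linarith
    exact (measureReal_eq_zero_iff).1 (le_antisymm hle measureReal_nonneg)
  have hinv : (fun x => S.toPerm.symm x) =ᵐ[μ] fun x => T.toPerm.symm x := by
    refine Filter.EventuallyEq.of_forall_separating_preimage MeasurableSet fun U hU => ?_
    have := measure_symmDiff_eq_zero_iff.1 (hall U hU)
    rwa [Equiv.image_eq_preimage_symm, Equiv.image_eq_preimage_symm] at this
  apply MeasAut.ext_ae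
  filter_upwards [S.toPerm_mem.1.quasiMeasurePreserving.ae hinv] with x hx
  rw [Equiv.symm_apply_apply, eq_comm, Equiv.symm_apply_eq] at hx
  exact hx

/-- `Aut(μ)` as a metric space, with the Halmos metric. -/
@[reducible]
noncomputable def halmosMetricSpace {X : Type*} [MeasurableSpace X] [StandardBorelSpace X]
    {μ : Measure X} [IsProbabilityMeasure μ] (𝒜 : DenseFamily μ) : MetricSpace (MeasAut μ) where
  dist := halmosDist 𝒜
  dist_self S := by simp [halmosDist]
  dist_comm S T := by simp only [halmosDist, symmDiff_comm]
  dist_triangle S T R := by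
    unfold halmosDist
    rw [← (summable_halmos 𝒜 S T).tsum_add (summable_halmos 𝒜 T R)]
    refine (summable_halmos 𝒜 S R).tsum_le_tsum (fun i => ?_)
      ((summable_halmos 𝒜 S T).add (summable_halmos 𝒜 T R))
    rw [← mul_add]
    refine mul_le_mul_of_nonneg_left ?_ (by positivity)
    have t1 := measureReal_symmDiff_le (μ := μ) (s := S.toPerm '' 𝒜.sets i)
      (t := T.toPerm '' 𝒜.sets i) (R.toPerm '' 𝒜.sets i)
    have t2 := measureReal_symmDiff_le (μ := μ) (s := (S⁻¹).toPerm '' 𝒜.sets i)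
      (t := (T⁻¹).toPerm '' 𝒜.sets i) ((R⁻¹).toPerm '' 𝒜.sets i)
    linarith
  eq_of_dist_eq_zero {S T} h := eq_of_halmosDist_eq_zero 𝒜 S T h

end Halmos

section SkewProducts

/-- `(T x)` is a measurable family of automorphisms and `R(x, y) = (S x, T_x y)` a.e.
Every clause depends only on the a.e. classes of `R`, `S` and `T x`; measurability of the family
is that of `x ↦ T x` for the weak topology of `Aut(μ)`. -/
structure IsSkewProduct {X : Type*} [MeasurableSpace X] {μ : Measure X}
    (R : MeasAut (μ.prod μ)) (S : MeasAut μ) (T : X → MeasAut μ) : Prop where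
  measurable : ∀ B C : Set X, MeasurableSet B → MeasurableSet C →
    Measurable fun x => μ (((T x).toPerm '' B) ∩ C)
  ae_eq : ∀ᵐ x ∂μ, ∀ᵐ y ∂μ, R.toPerm (x, y) = (S.toPerm x, (T x).toPerm y)

/-- `Ext(S)`: the skew products over `S` with fibre `(X, μ)`. -/
def Ext {X : Type*} [MeasurableSpace X] {μ : Measure X} (S : MeasAut μ) :
    Set (MeasAut (μ.prod μ)) :=
  {R | ∃ T : X → MeasAut μ, IsSkewProduct R S T}

/-- The family `T x` of the skew product `R = (S, T_x)`. -/
noncomputable def fiberFamily {X : Type*} [MeasurableSpace X] {μ : Measure X} {S : MeasAut μ}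
    (R : Ext S) : X → MeasAut μ :=
  R.2.choose

/-- The family of a skew product is unique up to a null set of `x`. -/
theorem fiberFamily_unique {X : Type*} [MeasurableSpace X] {μ : Measure X} {S : MeasAut μ}
    (R : Ext S) (T : X → MeasAut μ) (hT : IsSkewProduct R.1 S T) :
    ∀ᵐ x ∂μ, fiberFamily R x = T x := by
  filter_upwards [R.2.choose_spec.ae_eq, hT.ae_eq] with x h1 h2
  apply MeasAut.ext_ae
  filter_upwards [h1, h2] with y h3 h4
  exact (Prod.ext_iff.1 (h3.symm.trans h4)).2

/-- The cocycle `C(x, n, R) = T_{S^{n-1} x} ⋯ T_{S x} T_x`. -/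
noncomputable def cocycle {X : Type*} [MeasurableSpace X] {μ : Measure X} {S : MeasAut μ}
    (R : Ext S) (x : X) : ℕ → MeasAut μ
  | 0 => 1
  | n + 1 => fiberFamily R ((⇑S.toPerm)^[n] x) * cocycle R x n

/-- `D(m, n, R, A) = {x ∈ A : ρ(C(x, n, R), Id) < 1/m}`. -/
def returnSet {X : Type*} [MeasurableSpace X] {μ : Measure X} (𝒜 : DenseFamily μ)
    {S : MeasAut μ} (m n : ℕ) (R : Ext S) (A : Set X) : Set X :=
  {x | x ∈ A ∧ halmosDist 𝒜 (cocycle R x n) 1 < 1 / (m : ℝ)}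

/-- `Rec(S, A)`: the extensions of `S` that are recurrent on `A`. -/
def Rec {X : Type*} [MeasurableSpace X] {μ : Measure X} (𝒜 : DenseFamily μ)
    (S : MeasAut μ) (A : Set X) : Set (Ext S) :=
  {R | ∀ m N : ℕ, 1 ≤ m → ∃ n : ℕ, N < n ∧ 0 < μ (returnSet 𝒜 m n R A)}

end SkewProducts

end SkewRec

/-! `Rec 𝒜 S A` is itself a dense Gδ.

Gδ: for fixed `m` and `N`, the condition is a union over `n > N` of open conditions. Indeed `R ↦ R ^
n` is continuous, and by Fubini and Markov's inequality nearby iterates have cocycles that are close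
outside a small set of base points. A positive-measure return set leaves some slack, which absorbs
this set (`eventually_returnSet_pos`).

Density: let `P = S × id`. Extensions `V⁻¹ * P * V`, with `V` acting fibrewise by `T x`, have
cocycle `(T (Sⁿx))⁻¹ * T x`. Pull the weak topology back to `X` along `x ↦ T x`; Poincaré recurrence
brings `Sⁿx` back near `x` infinitely often for a.e. `x`, so the cocycle returns near the identity
(`coboundary_mem_Rec`). Such coboundaries are dense: by aperiodicity there is a set `B` of small
measure hit by almost every orbit (`exists_marker`). With `k` the hitting time of `B`, the map `V =
P⁻ᵏ Rᵏ` satisfies `P V = V R` off `B × X`, and automorphisms agreeing off a small set are close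
(`exists_coboundary_close`). -/

namespace SkewRec

/-! ### Representatives of automorphisms and the Halmos metric through preimages -/

section Basic

variable {X : Type*} [MeasurableSpace X] {μ : Measure X}

namespace MeasAut

theorem measurePreserving (S : MeasAut μ) : MeasurePreserving S.toPerm μ μ := S.toPerm_mem.1

theorem measurePreserving_symm (S : MeasAut μ) : MeasurePreserving S.toPerm.symm μ μ :=
  S.toPerm_mem.2

theorem ae_of_ae (S : MeasAut μ) {p : X → Prop} (h : ∀ᵐ x ∂μ, p x) :
    ∀ᵐ x ∂μ, p (S.toPerm x) :=
  S.measurePreserving.quasiMeasurePreserving.ae h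

theorem ae_symm_of_ae (S : MeasAut μ) {p : X → Prop} (h : ∀ᵐ x ∂μ, p x) :
    ∀ᵐ x ∂μ, p (S.toPerm.symm x) :=
  S.measurePreserving_symm.quasiMeasurePreserving.ae h

theorem toPerm_one : ∀ᵐ x ∂μ, (1 : MeasAut μ).toPerm x = x :=
  MeasAut.toPerm_mk (1 : mpPerm μ)

theorem toPerm_mul (S T : MeasAut μ) : ∀ᵐ x ∂μ, (S * T).toPerm x = S.toPerm (T.toPerm x) := by
  have h := MeasAut.toPerm_mk (μ := μ) (Quotient.out S * Quotient.out T : mpPerm μ)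
  have e : (QuotientGroup.mk (Quotient.out S * Quotient.out T : mpPerm μ) : MeasAut μ) = S * T := by
    rw [QuotientGroup.mk_mul, QuotientGroup.out_eq', QuotientGroup.out_eq']
  rw [e] at h
  exact h

theorem toPerm_inv (S : MeasAut μ) : ∀ᵐ x ∂μ, S⁻¹.toPerm x = S.toPerm.symm x := by
  have h := MeasAut.toPerm_mk (μ := μ) ((Quotient.out S : mpPerm μ)⁻¹)
  have e : (QuotientGroup.mk ((Quotient.out S : mpPerm μ)⁻¹) : MeasAut μ) = S⁻¹ := by
    rw [QuotientGroup.mk_inv, QuotientGroup.out_eq']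
  rw [e] at h
  exact h

/-- Measure preserving maps that are a.e. inverse to each other define an automorphism. -/
theorem exists_of_ae_inverse [MeasurableEq X] {f g : X → X} (hf : MeasurePreserving f μ μ)
    (hg : MeasurePreserving g μ μ) (hgf : ∀ᵐ x ∂μ, g (f x) = x) (hfg : ∀ᵐ x ∂μ, f (g x) = x) :
    ∃ S : MeasAut μ, ∀ᵐ x ∂μ, S.toPerm x = f x := by
  classical
  -- Asking for the inverse relations along both whole orbits makes `Z` invariant under `f` and `g`.
  -- Hence `f` on `Z` and the identity elsewhere form a genuine bijection.
  let Z : Set X := {x | ∀ n : ℕ, (g (f (f^[n] x)) = f^[n] x ∧ f (g (f^[n] x)) = f^[n] x) ∧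
    (g (f (g^[n] x)) = g^[n] x ∧ f (g (g^[n] x)) = g^[n] x)}
  have hZm : MeasurableSet Z := by
    have e : ∀ (u v : X → X), Measurable u → Measurable v → MeasurableSet {x | u x = v x} :=
      fun u v hu hv => measurableSet_eq_fun hu hv
    simp only [Z, Set.ofPred_forall]
    refine MeasurableSet.iInter fun n => ?_
    have a := hf.measurable.iterate n
    have b := hg.measurable.iterate n
    exact ((e _ _ (hg.measurable.comp (hf.measurable.comp a)) a).inter
      (e _ _ (hf.measurable.comp (hg.measurable.comp a)) a)).inter
      ((e _ _ (hg.measurable.comp (hf.measurable.comp b)) b).inter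
      (e _ _ (hf.measurable.comp (hg.measurable.comp b)) b))
  have hZ : ∀ᵐ x ∂μ, x ∈ Z := by
    refine ae_all_iff.2 fun n => ?_
    have a := (hf.iterate n).quasiMeasurePreserving
    have b := (hg.iterate n).quasiMeasurePreserving
    filter_upwards [a.ae hgf, a.ae hfg, b.ae hgf, b.ae hfg] with x h1 h2 h3 h4
    exact ⟨⟨h1, h2⟩, h3, h4⟩
  have h0 : ∀ x ∈ Z, g (f x) = x ∧ f (g x) = x := fun x hx => (hx 0).1
  have hfZ : ∀ x ∈ Z, f x ∈ Z := by
    intro x hx n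
    refine ⟨by simpa only [Function.iterate_succ_apply] using (hx (n + 1)).1, ?_⟩
    cases n with
    | zero => simpa using (hx 1).1
    | succ n =>
      rw [Function.iterate_succ_apply, (h0 x hx).1]
      exact (hx n).2
  have hgZ : ∀ x ∈ Z, g x ∈ Z := by
    intro x hx n
    refine ⟨?_, by simpa only [Function.iterate_succ_apply] using (hx (n + 1)).2⟩
    cases n with
    | zero => simpa using (hx 1).2
    | succ n =>
      rw [Function.iterate_succ_apply, (h0 x hx).2]
      exact (hx n).1
  let e : Equiv.Perm X :=
    { toFun := fun x => if x ∈ Z then f x else x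
      invFun := fun x => if x ∈ Z then g x else x
      left_inv := by
        intro x
        by_cases hx : x ∈ Z
        · simp [hx, hfZ x hx, (h0 x hx).1]
        · simp [hx]
      right_inv := by
        intro x
        by_cases hx : x ∈ Z
        · simp [hx, hgZ x hx, (h0 x hx).2]
        · simp [hx] }
  have he : ⇑e =ᵐ[μ] f := by
    filter_upwards [hZ] with x hx
    exact if_pos hx
  have he' : ⇑e.symm =ᵐ[μ] g := by
    filter_upwards [hZ] with x hx
    exact if_pos hx
  have hem : Measurable e := Measurable.ite hZm hf.measurable measurable_id
  have hem' : Measurable e.symm := Measurable.ite hZm hg.measurable measurable_id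
  refine ⟨QuotientGroup.mk ⟨e, ⟨hem, ?_⟩, ⟨hem', ?_⟩⟩, ?_⟩
  · rw [Measure.map_congr he, hf.map_eq]
  · rw [Measure.map_congr he', hg.map_eq]
  · filter_upwards [MeasAut.toPerm_mk (μ := μ) ⟨e, ⟨hem, by rw [Measure.map_congr he, hf.map_eq]⟩,
      ⟨hem', by rw [Measure.map_congr he', hg.map_eq]⟩⟩, he] with x h1 h2
    rw [h1, ← h2]

end MeasAut

/-- The measure of the symmetric difference of the preimages of `E`. -/
noncomputable def preimageDist (μ : Measure X) (E : Set X) (S T : MeasAut μ) : ℝ :=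
  μ.real ((S.toPerm ⁻¹' E) ∆ (T.toPerm ⁻¹' E))

theorem preimage_ae_congr {f g : X → X} (h : ∀ᵐ x ∂μ, f x = g x) (E : Set X) :
    f ⁻¹' E =ᵐ[μ] g ⁻¹' E := by
  filter_upwards [h] with x hx
  exact propext (by change f x ∈ E ↔ g x ∈ E; rw [hx])

theorem real_symmDiff_congr {A A' B B' : Set X} (hA : A =ᵐ[μ] A') (hB : B =ᵐ[μ] B') :
    μ.real (A ∆ B) = μ.real (A' ∆ B') :=
  measureReal_congr (hA.symmDiff hB)

theorem image_ae_eq_preimage_inv (S : MeasAut μ) (E : Set X) :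
    S.toPerm '' E =ᵐ[μ] S⁻¹.toPerm ⁻¹' E := by
  rw [Equiv.image_eq_preimage_symm]
  exact preimage_ae_congr (S.toPerm_inv.mono fun x hx => hx.symm) E

theorem inv_image_ae_eq_preimage (S : MeasAut μ) (E : Set X) :
    S⁻¹.toPerm '' E =ᵐ[μ] S.toPerm ⁻¹' E := by
  simpa using image_ae_eq_preimage_inv S⁻¹ E

theorem halmosDist_eq_tsum (𝒜 : DenseFamily μ) (S T : MeasAut μ) :
    halmosDist 𝒜 S T = ∑' i : ℕ, (1 / 2 : ℝ) ^ (i + 1) *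
      (preimageDist μ (𝒜.sets i) S⁻¹ T⁻¹ + preimageDist μ (𝒜.sets i) S T) := by
  unfold halmosDist preimageDist
  refine tsum_congr fun i => ?_
  rw [real_symmDiff_congr (image_ae_eq_preimage_inv S _) (image_ae_eq_preimage_inv T _),
    real_symmDiff_congr (inv_image_ae_eq_preimage S _) (inv_image_ae_eq_preimage T _)]

theorem preimageDist_mul_right {E : Set X} (hE : MeasurableSet E) (S T R : MeasAut μ) :
    preimageDist μ E (S * R) (T * R) = preimageDist μ E S T := by
  unfold preimageDist
  rw [real_symmDiff_congr (preimage_ae_congr (MeasAut.toPerm_mul S R) E)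
    (preimage_ae_congr (MeasAut.toPerm_mul T R) E)]
  change μ.real ((R.toPerm ⁻¹' (S.toPerm ⁻¹' E)) ∆ (R.toPerm ⁻¹' (T.toPerm ⁻¹' E))) = _
  rw [← Set.preimage_symmDiff]
  exact R.measurePreserving.measureReal_preimage
    ((S.measurePreserving.measurable hE).symmDiff
      (T.measurePreserving.measurable hE)).nullMeasurableSet

theorem preimageDist_comm (E : Set X) (S T : MeasAut μ) :
    preimageDist μ E S T = preimageDist μ E T S := by
  rw [preimageDist, symmDiff_comm, preimageDist]

theorem preimageDist_nonneg (E : Set X) (S T : MeasAut μ) : 0 ≤ preimageDist μ E S T :=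
  measureReal_nonneg

theorem preimageDist_inv_one {E : Set X} (hE : MeasurableSet E) (S : MeasAut μ) :
    preimageDist μ E S⁻¹ 1 = preimageDist μ E S 1 := by
  have h := preimageDist_mul_right hE S⁻¹ 1 S
  rw [inv_mul_cancel, one_mul, preimageDist_comm] at h
  exact h.symm

/-- Against the identity the forward and inverse terms coincide, since `S` preserves `μ`; this
doubles the weights. -/
theorem halmosDist_one (𝒜 : DenseFamily μ) (S : MeasAut μ) :
    halmosDist 𝒜 S 1 = ∑' i : ℕ, (1 / 2 : ℝ) ^ i * preimageDist μ (𝒜.sets i) S 1 := by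
  rw [halmosDist_eq_tsum]
  refine tsum_congr fun i => ?_
  rw [inv_one, preimageDist_inv_one (𝒜.measurable i), pow_succ]
  ring

variable [IsProbabilityMeasure μ]

theorem preimageDist_le_one (E : Set X) (S T : MeasAut μ) : preimageDist μ E S T ≤ 1 :=
  measureReal_le_one

theorem preimageDist_triangle (E : Set X) (S T R : MeasAut μ) :
    preimageDist μ E S R ≤ preimageDist μ E S T + preimageDist μ E T R :=
  measureReal_symmDiff_le _

theorem preimageDist_le_halmosDist (𝒜 : DenseFamily μ) (S T : MeasAut μ) (i : ℕ) :
    preimageDist μ (𝒜.sets i) S T ≤ 2 ^ (i + 1) * halmosDist 𝒜 S T := by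
  have h := (summable_halmos 𝒜 S T).le_tsum i fun j _ => by positivity
  rw [real_symmDiff_congr (image_ae_eq_preimage_inv S _) (image_ae_eq_preimage_inv T _),
    real_symmDiff_congr (inv_image_ae_eq_preimage S _) (inv_image_ae_eq_preimage T _)] at h
  have h' : (1 / 2 : ℝ) ^ (i + 1) * preimageDist μ (𝒜.sets i) S T ≤ halmosDist 𝒜 S T :=
    le_trans (mul_le_mul_of_nonneg_left (le_add_of_nonneg_left measureReal_nonneg)
      (by positivity)) h
  calc preimageDist μ (𝒜.sets i) S T
      = 2 ^ (i + 1) * ((1 / 2 : ℝ) ^ (i + 1) * preimageDist μ (𝒜.sets i) S T) := by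
        rw [← mul_assoc, ← mul_pow]; norm_num
    _ ≤ _ := by gcongr

/-- Automorphisms that agree off a small set are close. -/
theorem halmosDist_le_of_eq_off (𝒜 : DenseFamily μ) (S T : MeasAut μ) {P : Set X}
    (hP : MeasurableSet P) (h : ∀ᵐ x ∂μ, x ∉ P → S.toPerm x = T.toPerm x) :
    halmosDist 𝒜 S T ≤ 2 * μ.real P := by
  have h1 : ∀ i, preimageDist μ (𝒜.sets i) S T ≤ μ.real P := fun i => by
    refine ENNReal.toReal_mono (measure_ne_top _ _) (measure_mono_ae ?_)
    filter_upwards [h] with x hx hxs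
    by_contra hxP
    have e := hx hxP
    rcases hxs with ⟨a, b⟩ | ⟨a, b⟩ <;> simp only [Set.mem_preimage, e] at a b <;> exact b a
  have h2 : ∀ i, preimageDist μ (𝒜.sets i) S⁻¹ T⁻¹ ≤ μ.real P := fun i => by
    rw [← S.measurePreserving_symm.measureReal_preimage hP.nullMeasurableSet]
    refine ENNReal.toReal_mono (measure_ne_top _ _) (measure_mono_ae ?_)
    filter_upwards [S.ae_symm_of_ae h, S.toPerm_inv, T.toPerm_inv] with x hx hS hT hxs
    by_contra hxP
    have e : S⁻¹.toPerm x = T⁻¹.toPerm x := by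
      have := hx hxP
      rw [Equiv.apply_symm_apply] at this
      rw [hS, hT, eq_comm, Equiv.symm_apply_eq]
      exact this
    rcases hxs with ⟨a, b⟩ | ⟨a, b⟩ <;> simp only [Set.mem_preimage, e] at a b <;> exact b a
  rw [halmosDist_eq_tsum]
  have hs : HasSum (fun i : ℕ => (1 / 2 : ℝ) ^ i * μ.real P) (2 * μ.real P) :=
    hasSum_geometric_two.mul_right _
  refine tsum_le_of_sum_le' (by positivity) fun s => ?_
  refine le_trans (Finset.sum_le_sum fun i _ => ?_) (sum_le_hasSum s (fun i _ => by positivity) hs)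
  rw [pow_succ, mul_assoc]
  refine mul_le_mul_of_nonneg_left ?_ (by positivity)
  linarith [h1 i, h2 i]

end Basic

/-! ### Markers for aperiodic automorphisms -/

section Marker

/-- The greedy union of sets `D j`, each new piece staying `N`-separated from the previous ones
along the orbits of `s`. -/
def greedyUnion {X : Type*} (s : Equiv.Perm X) (N : ℕ) (D : ℕ → Set X) : ℕ → Set X
  | 0 => ∅
  | j + 1 => greedyUnion s N D j ∪ {x | x ∈ D j ∧ ∀ i ≤ N,
      s^[i] x ∉ greedyUnion s N D j ∧ s.symm^[i] x ∉ greedyUnion s N D j}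

theorem measurableSet_greedyUnion {X : Type*} [MeasurableSpace X] {s : Equiv.Perm X}
    (hs : Measurable s) (hs' : Measurable s.symm) (N : ℕ) {D : ℕ → Set X} (hD : ∀ j, MeasurableSet (D j)) (j : ℕ) :
    MeasurableSet (greedyUnion s N D j) := by
  induction j with
  | zero => exact MeasurableSet.empty
  | succ j ih =>
    refine ih.union ((hD j).inter ?_)
    have : {x | ∀ i ≤ N, s^[i] x ∉ greedyUnion s N D j ∧ s.symm^[i] x ∉ greedyUnion s N D j} =
        ⋂ i, ⋂ (_ : i ≤ N), ((s^[i] ⁻¹' greedyUnion s N D j)ᶜ ∩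
          (s.symm^[i] ⁻¹' greedyUnion s N D j)ᶜ) := by
      ext x; simp
    change MeasurableSet {x | ∀ i ≤ N, s^[i] x ∉ greedyUnion s N D j ∧
      s.symm^[i] x ∉ greedyUnion s N D j}
    rw [this]
    exact MeasurableSet.iInter fun i => MeasurableSet.iInter fun _ =>
      ((hs.iterate i) ih).compl.inter ((hs'.iterate i) ih).compl

theorem greedyUnion_mono {X : Type*} (s : Equiv.Perm X) (N : ℕ) (D : ℕ → Set X) :
    Monotone (greedyUnion s N D) :=
  monotone_nat_of_le_succ fun _ => Set.subset_union_left

/-- A new point is tested against the old set in both time directions, so it can neither precede nor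
follow an old point within `N` steps; two new points are handled by the separation of `D j`. -/
theorem greedyUnion_separated {X : Type*} {s : Equiv.Perm X} {N : ℕ} {D : ℕ → Set X}
    (hD : ∀ j, ∀ x ∈ D j, ∀ i, 1 ≤ i → i ≤ N → s^[i] x ∉ D j) (j : ℕ) :
    ∀ x ∈ greedyUnion s N D j, ∀ i, 1 ≤ i → i ≤ N → s^[i] x ∉ greedyUnion s N D j := by
  induction j with
  | zero => intro x hx; exact hx.elim
  | succ j ih =>
    rintro x (hx | ⟨hx, hx'⟩) i h1 hN (hy | ⟨hy, hy'⟩)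
    · exact ih x hx i h1 hN hy
    · have := (hy' i hN).2
      rw [(Function.LeftInverse.iterate s.symm_apply_apply i) x] at this
      exact this hx
    · exact (hx' i hN).1 hy
    · exact hD j x hx i h1 hN hy

/-- An aperiodic automorphism has markers: sets of small measure met by almost every forward
orbit. -/
theorem MeasAut.Aperiodic.exists_marker {X : Type*} [MeasurableSpace X] [StandardBorelSpace X]
    {μ : Measure X} [IsProbabilityMeasure μ] {S : MeasAut μ} (hS : S.Aperiodic) (N : ℕ) :
    ∃ B : Set X, MeasurableSet B ∧ ((N : ℝ) + 1) * μ.real B ≤ 1 ∧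
      ∀ᵐ x ∂μ, ∃ n : ℕ, S.toPerm^[n] x ∈ B := by
  let := upgradeStandardBorel X
  set s := S.toPerm with hs_def
  have hs := S.measurePreserving
  have hs' := S.measurePreserving_symm
  have hne : (TopologicalSpace.countableBasis X).Nonempty := by
    obtain ⟨x⟩ := nonempty_of_isProbabilityMeasure μ
    obtain ⟨v, hv, -⟩ := (TopologicalSpace.isBasis_countableBasis X).exists_subset_of_mem_open
      (Set.mem_univ x) isOpen_univ
    exact ⟨v, hv⟩
  obtain ⟨E, hE⟩ := (TopologicalSpace.countable_countableBasis X).exists_eq_range hne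
  have hEo : ∀ j, IsOpen (E j) := fun j =>
    TopologicalSpace.isOpen_of_mem_countableBasis (hE ▸ Set.mem_range_self j)
  -- The points of a basic open set that do not return to it within `N` steps. A nonperiodic point
  -- has a basic neighbourhood avoiding its next `N` iterates, so the sets `D j` cover almost
  -- everything.
  let D : ℕ → Set X := fun j => E j ∩ ⋂ i, ⋂ (_ : 1 ≤ i ∧ i ≤ N), (s^[i] ⁻¹' E j)ᶜ
  have memD : ∀ j x, x ∈ D j ↔ x ∈ E j ∧ ∀ i, 1 ≤ i → i ≤ N → s^[i] x ∉ E j := by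
    intro j x; simp [D]
  have hDm : ∀ j, MeasurableSet (D j) := fun j => (hEo j).measurableSet.inter
    (MeasurableSet.iInter fun i => MeasurableSet.iInter fun _ =>
      ((hs.measurable.iterate i) (hEo j).measurableSet).compl)
  have hDsep : ∀ j, ∀ x ∈ D j, ∀ i, 1 ≤ i → i ≤ N → s^[i] x ∉ D j := fun j x hx i h1 h2 h =>
    ((memD j x).1 hx).2 i h1 h2 ((memD j _).1 h).1
  set C := greedyUnion s N D with hC
  have hCm := measurableSet_greedyUnion hs.measurable hs'.measurable N hDm
  have hUm : MeasurableSet (⋃ j, C j) := MeasurableSet.iUnion hCm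
  have hUsep : ∀ x ∈ ⋃ j, C j, ∀ i, 1 ≤ i → i ≤ N → s^[i] x ∉ ⋃ j, C j := by
    intro x hx i h1 h2 hy
    obtain ⟨j, hj⟩ := Set.mem_iUnion.1 hx
    obtain ⟨k, hk⟩ := Set.mem_iUnion.1 hy
    exact greedyUnion_separated hDsep (max j k) x
      (greedyUnion_mono s N D (le_max_left j k) hj) i h1 h2
      (greedyUnion_mono s N D (le_max_right j k) hk)
  have hcov : ∀ᵐ x ∂μ, ∃ j, x ∈ D j := by
    filter_upwards [hS] with x hx
    have hfin : ((fun i => s^[i] x) '' Set.Icc 1 N).Finite := (Set.finite_Icc 1 N).image _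
    have hxn : x ∈ ((fun i => s^[i] x) '' Set.Icc 1 N)ᶜ := by
      rintro ⟨i, hi, h⟩
      exact hx i hi.1 h
    obtain ⟨v, hv, hxv, hsub⟩ :=
      (TopologicalSpace.isBasis_countableBasis X).exists_subset_of_mem_open hxn hfin.isClosed.isOpen_compl
    rw [hE] at hv
    obtain ⟨j, rfl⟩ := hv
    exact ⟨j, (memD j x).2 ⟨hxv, fun i h1 h2 h => hsub h ⟨i, ⟨h1, h2⟩, rfl⟩⟩⟩
  refine ⟨⋃ j, C j, hUm, ?_, ?_⟩
  -- Separation makes the `N + 1` preimages of the marker disjoint, and they all have its measure.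
  · have hdisj : Pairwise (Function.onFun Disjoint
        fun i : Fin (N + 1) => s^[i] ⁻¹' ⋃ j, C j) := by
      have key : ∀ a b : ℕ, a < b → b ≤ N →
          Disjoint (s^[a] ⁻¹' ⋃ j, C j) (s^[b] ⁻¹' ⋃ j, C j) := by
        intro a b hab hb
        rw [Set.disjoint_left]
        intro x hx hy
        refine hUsep _ hx (b - a) (by omega) (by omega) ?_
        rw [← Function.iterate_add_apply, Nat.sub_add_cancel hab.le]
        exact hy
      intro a b hab
      rcases lt_or_gt_of_ne (fun h => hab (Fin.ext h) : (a : ℕ) ≠ b) with h | h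
      · exact key a b h (by omega)
      · exact (key b a h (by omega)).symm
    have h := measureReal_iUnion_fintype (μ := μ) hdisj fun i => (hs.measurable.iterate i) hUm
    have h1 : ∀ i : Fin (N + 1), μ.real (s^[i] ⁻¹' ⋃ j, C j) = μ.real (⋃ j, C j) := fun i =>
      (hs.iterate i).measureReal_preimage hUm.nullMeasurableSet
    simp only [h1, Finset.sum_const, Finset.card_univ, Fintype.card_fin, nsmul_eq_mul] at h
    have h2 : μ.real (⋃ i : Fin (N + 1), s^[i] ⁻¹' ⋃ j, C j) ≤ 1 := measureReal_le_one
    rw [h] at h2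
    push_cast at h2
    exact h2
  -- Maximality of the greedy choice: a point of `D j` is either added at stage `j + 1` or was
  -- refused because of an earlier point within `N` steps.
  · have hnear : ∀ᵐ x ∂μ, ∃ i ≤ N, s^[i] x ∈ ⋃ j, C j ∨ s.symm^[i] x ∈ ⋃ j, C j := by
      filter_upwards [hcov] with x ⟨j, hj⟩
      by_cases h : ∀ i ≤ N, s^[i] x ∉ C j ∧ s.symm^[i] x ∉ C j
      · exact ⟨0, Nat.zero_le _, Or.inl (Set.mem_iUnion.2 ⟨j + 1, Or.inr ⟨hj, h⟩⟩)⟩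
      · push Not at h
        obtain ⟨i, hi, h⟩ := h
        by_cases h' : s^[i] x ∈ C j
        · exact ⟨i, hi, Or.inl (Set.mem_iUnion.2 ⟨j, h'⟩)⟩
        · exact ⟨i, hi, Or.inr (Set.mem_iUnion.2 ⟨j, h h'⟩)⟩
    -- Looking from the `N`-th iterate of `x` turns a backward hit into a forward one.
    filter_upwards [(hs.iterate N).quasiMeasurePreserving.ae hnear] with x ⟨i, hi, h⟩
    rcases h with h | h
    · exact ⟨i + N, by rwa [Function.iterate_add_apply]⟩
    · refine ⟨N - i, ?_⟩
      have e : N = i + (N - i) := by omega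
      rw [e, Function.iterate_add_apply,
        (Function.LeftInverse.iterate s.symm_apply_apply i)] at h
      exact h

end Marker

/-! ### Automorphisms over `S` are skew products -/

section Fibres

variable {X : Type*} [MeasurableSpace X] {μ : Measure X}

open ProbabilityTheory

/-- Uniqueness of disintegration: the fibre laws `κ x` and the constant kernel `μ` have the same
composition-product with `μ`, because `R` preserves `μ.prod μ` and `S` preserves `μ`. -/
theorem ae_measurePreserving_fibre [StandardBorelSpace X] [IsProbabilityMeasure μ]
    {S : MeasAut μ} {R : MeasAut (μ.prod μ)}
    (h : ∀ᵐ z ∂μ.prod μ, (R.toPerm z).1 = S.toPerm z.1) :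
    ∀ᵐ x ∂μ, MeasurePreserving (fun y => (R.toPerm (x, y)).2) μ μ := by
  have hm : Measurable fun z => (R.toPerm z).2 := measurable_snd.comp R.measurePreserving.measurable
  let κ : Kernel X X := (Kernel.id ×ₖ Kernel.const X μ).map fun z => (R.toPerm z).2
  have hκ : ∀ x, κ x = μ.map fun y => (R.toPerm (x, y)).2 := by
    intro x
    rw [Kernel.map_apply _ hm, Kernel.prod_apply, Kernel.id_apply, Kernel.const_apply,
      Measure.dirac_prod, Measure.map_map hm measurable_prodMk_left]
    rfl
  have hmk : IsMarkovKernel κ := Kernel.IsMarkovKernel.map _ hm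
  have hκ_eq : μ ⊗ₘ κ = μ ⊗ₘ Kernel.const X μ := by
    refine Measure.ext_prod_iff.2 fun {P} {C} hP hC => ?_
    rw [Measure.compProd_apply_prod hP hC, Measure.compProd_const, Measure.prod_prod]
    have h1 : ∫⁻ x in P, κ x C ∂μ = (μ.prod μ) {z | z.1 ∈ P ∧ (R.toPerm z).2 ∈ C} := by
      have hPC : MeasurableSet {z : X × X | z.1 ∈ P ∧ (R.toPerm z).2 ∈ C} :=
        (measurable_fst hP).inter (hm hC)
      rw [Measure.prod_apply hPC, ← lintegral_indicator hP]
      refine lintegral_congr fun x => ?_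
      by_cases hx : x ∈ P
      · rw [Set.indicator_of_mem hx, hκ, Measure.map_apply
          (show Measurable fun y => (R.toPerm (x, y)).2 from hm.comp measurable_prodMk_left) hC]
        congr 1
        ext y
        simp [hx]
      · rw [Set.indicator_of_notMem hx]
        simp [hx]
    have h2 : {z : X × X | z.1 ∈ P ∧ (R.toPerm z).2 ∈ C} =ᵐ[μ.prod μ]
        R.toPerm ⁻¹' ((S.toPerm.symm ⁻¹' P) ×ˢ C) := by
      filter_upwards [h] with z hz
      refine propext ?_
      change (z.1 ∈ P ∧ (R.toPerm z).2 ∈ C) ↔ (S.toPerm.symm (R.toPerm z).1 ∈ P ∧ _)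
      rw [hz, Equiv.symm_apply_apply]
    rw [h1, measure_congr h2, R.measurePreserving.measure_preimage
      ((S.measurePreserving_symm.measurable hP).prod hC).nullMeasurableSet, Measure.prod_prod,
      S.measurePreserving_symm.measure_preimage hP.nullMeasurableSet]
  filter_upwards [Kernel.ae_eq_of_compProd_eq hκ_eq] with x hx
  refine ⟨hm.comp measurable_prodMk_left, ?_⟩
  rw [← hκ, hx, Kernel.const_apply]

theorem fst_inv {S : MeasAut μ} {R : MeasAut (μ.prod μ)} [SFinite μ]
    (h : ∀ᵐ z ∂μ.prod μ, (R.toPerm z).1 = S.toPerm z.1) :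
    ∀ᵐ z ∂μ.prod μ, (R⁻¹.toPerm z).1 = S⁻¹.toPerm z.1 := by
  have hq : Measure.QuasiMeasurePreserving Prod.fst (μ.prod μ) μ :=
    Measure.quasiMeasurePreserving_fst
  filter_upwards [R.ae_symm_of_ae h, R.toPerm_inv, hq.ae S.toPerm_inv] with z h1 h2 h3
  rw [h2, h3, eq_comm, Equiv.symm_apply_eq, ← h1, Equiv.apply_symm_apply]

/-- An automorphism of the product that permutes the fibres as `S` does is a skew product. -/
theorem mem_Ext_of_fst [StandardBorelSpace X] [IsProbabilityMeasure μ]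
    {S : MeasAut μ} {R : MeasAut (μ.prod μ)}
    (h : ∀ᵐ z ∂μ.prod μ, (R.toPerm z).1 = S.toPerm z.1) : R ∈ Ext S := by
  classical
  have hR := R.measurePreserving
  have hex : ∀ᵐ x ∂μ, ∃ T : MeasAut μ, ∀ᵐ y ∂μ, R.toPerm (x, y) = (S.toPerm x, T.toPerm y) := by
    have e1 := Measure.ae_ae_of_ae_prod h
    have e2 := Measure.ae_ae_of_ae_prod (fst_inv h)
    have e3 := Measure.ae_ae_of_ae_prod R.toPerm_inv
    -- The fibre map of `R` over `x` is a.e. inverse to that of `R⁻¹` over `S x`.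
    filter_upwards [e1, S.ae_of_ae e2, S.ae_of_ae e3, S.ae_of_ae S.toPerm_inv,
      ae_measurePreserving_fibre h, S.ae_of_ae (ae_measurePreserving_fibre (fst_inv h))]
      with x h1 h2 h3 h4 hf hg
    obtain ⟨T, hT⟩ := MeasAut.exists_of_ae_inverse hf hg (by
      filter_upwards [h1, hf.quasiMeasurePreserving.ae h3] with y a b
      have e : (S.toPerm x, (R.toPerm (x, y)).2) = R.toPerm (x, y) := Prod.ext a.symm rfl
      rw [b, e, Equiv.symm_apply_apply]) (by
      filter_upwards [h2, h3] with y a b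
      have e : (x, (R⁻¹.toPerm (S.toPerm x, y)).2) = R.toPerm.symm (S.toPerm x, y) := by
        rw [← b]
        refine Prod.ext ?_ rfl
        rw [a, h4, Equiv.symm_apply_apply]
      rw [e, Equiv.apply_symm_apply])
    refine ⟨T, ?_⟩
    filter_upwards [h1, hT] with y a b
    exact Prod.ext a b.symm
  -- The family must be measurable everywhere, so it is set to `1` on a measurable null set `M`.
  obtain ⟨M, hMsub, hMm, hM0⟩ := exists_measurable_superset_of_null (ae_iff.1 hex)
  have hM : ∀ x ∉ M, ∃ T : MeasAut μ, ∀ᵐ y ∂μ, R.toPerm (x, y) = (S.toPerm x, T.toPerm y) := by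
    intro x hx
    by_contra hn
    exact hx (hMsub hn)
  refine ⟨fun x => if hx : x ∈ M then 1 else (hM x hx).choose, ?_, ?_⟩
  · intro B C hB hC
    have hT : ∀ T : MeasAut μ, μ ((T.toPerm '' B) ∩ C) = μ (B ∩ T.toPerm ⁻¹' C) := by
      intro T
      rw [← T.measurePreserving.measure_preimage (MeasurableSet.inter (by
        rw [Equiv.image_eq_preimage_symm]
        exact T.measurePreserving_symm.measurable hB) hC).nullMeasurableSet, Set.preimage_inter,
        Equiv.preimage_image]
    -- Off `M` the value is the measure of a section of a fixed measurable set, so the arbitrary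
    -- choice of `T x` does no harm.
    have e : (fun x => μ (((if hx : x ∈ M then (1 : MeasAut μ) else (hM x hx).choose).toPerm '' B)
        ∩ C)) = fun x => if x ∈ M then μ (B ∩ C)
          else μ (Prod.mk x ⁻¹' {z : X × X | z.2 ∈ B ∧ (R.toPerm z).2 ∈ C}) := by
      funext x
      by_cases hx : x ∈ M
      · simp only [hx, dite_true, if_true]
        rw [hT]
        refine measure_congr (EventuallyEq.rfl.inter (preimage_ae_congr MeasAut.toPerm_one C))
      · simp only [hx, dite_false, if_false]
        rw [hT]
        refine measure_congr ?_
        filter_upwards [(hM x hx).choose_spec] with y hy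
        refine propext ?_
        change (y ∈ B ∧ _ ∈ C) ↔ (y ∈ B ∧ (R.toPerm (x, y)).2 ∈ C)
        rw [hy]
    rw [e]
    exact Measurable.ite hMm measurable_const (measurable_measure_prodMk_left
      ((measurable_snd hB).inter ((measurable_snd.comp hR.measurable) hC)))
  · have : ∀ᵐ x ∂μ, x ∉ M := measure_eq_zero_iff_ae_notMem.1 hM0
    filter_upwards [this] with x hx
    simp only [hx, dite_false]
    exact (hM x hx).choose_spec

end Fibres

/-! ### Density of coboundaries -/

section Coboundary

variable {X : Type*} [MeasurableSpace X] {μ : Measure X}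

/-- Automorphisms that preserve the pieces of a countable measurable partition can be glued. -/
theorem exists_glue {Z : Type*} [MeasurableSpace Z] [MeasurableEq Z] {ν : Measure Z}
    {k : Z → ℕ} (hk : Measurable k) (W : ℕ → MeasAut ν)
    (hW : ∀ n, ∀ᵐ z ∂ν, k ((W n).toPerm z) = k z) :
    ∃ V : MeasAut ν, ∀ᵐ z ∂ν, V.toPerm z = (W (k z)).toPerm z := by
  have hW' : ∀ n, ∀ᵐ z ∂ν, k ((W n).toPerm.symm z) = k z := fun n => by
    filter_upwards [(W n).ae_symm_of_ae (hW n)] with z hz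
    rw [← hz, Equiv.apply_symm_apply]
  -- Stated for plain maps so as to apply both to the `W n` and to their inverses.
  have key : ∀ F : ℕ → Z → Z, (∀ n, MeasurePreserving (F n) ν ν) →
      (∀ n, ∀ᵐ z ∂ν, k (F n z) = k z) → MeasurePreserving (fun z => F (k z) z) ν ν := by
    intro F hF hFk
    have hm : Measurable fun z => F (k z) z := by
      have : Measurable fun p : ℕ × Z => F p.1 p.2 :=
        measurable_from_prod_countable_right fun n => (hF n).measurable
      exact this.comp (hk.prodMk measurable_id)
    refine ⟨hm, ?_⟩
    ext D hD
    rw [Measure.map_apply hm hD]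
    have hd : ∀ D' : Set Z, MeasurableSet D' → ν D' = ∑' n, ν (D' ∩ k ⁻¹' {n}) := by
      intro D' hD'
      rw [← measure_iUnion]
      · congr 1
        ext z
        simp
      · intro a b hab
        refine Set.disjoint_left.2 fun z h1 h2 => hab ?_
        exact h1.2.symm.trans h2.2
      · exact fun n => hD'.inter (hk (measurableSet_singleton n))
    rw [hd _ (hm hD), hd D hD]
    refine tsum_congr fun n => ?_
    rw [← (hF n).measure_preimage (hD.inter (hk (measurableSet_singleton n))).nullMeasurableSet]
    refine measure_congr ?_
    filter_upwards [hFk n] with z hz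
    refine propext ?_
    change (F (k z) z ∈ D ∧ k z = n) ↔ (F n z ∈ D ∧ k (F n z) = n)
    rw [hz]
    constructor
    · rintro ⟨a, rfl⟩; exact ⟨a, rfl⟩
    · rintro ⟨a, rfl⟩; exact ⟨a, rfl⟩
  refine MeasAut.exists_of_ae_inverse
    (key (fun n => (W n).toPerm) (fun n => (W n).measurePreserving) hW)
    (key (fun n => (W n).toPerm.symm) (fun n => (W n).measurePreserving_symm) hW') ?_ ?_
  · filter_upwards [ae_all_iff.2 hW] with z hz
    rw [hz, Equiv.symm_apply_apply]
  · filter_upwards [ae_all_iff.2 hW'] with z hz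
    rw [hz, Equiv.apply_symm_apply]

/-- The product of an automorphism with the identity. -/
theorem exists_prod_one [SFinite μ] (S : MeasAut μ) :
    ∃ P : MeasAut (μ.prod μ), ∀ᵐ z ∂μ.prod μ, P.toPerm z = (S.toPerm z.1, z.2) :=
  ⟨_, MeasAut.toPerm_mk (μ := μ.prod μ) ⟨Equiv.prodCongr S.toPerm (Equiv.refl X),
    S.measurePreserving.prod (MeasurePreserving.id μ),
    S.measurePreserving_symm.prod (MeasurePreserving.id μ)⟩⟩

theorem fst_mul [SFinite μ] {S T : MeasAut μ} {Q R : MeasAut (μ.prod μ)}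
    (hQ : ∀ᵐ z ∂μ.prod μ, (Q.toPerm z).1 = S.toPerm z.1)
    (hR : ∀ᵐ z ∂μ.prod μ, (R.toPerm z).1 = T.toPerm z.1) :
    ∀ᵐ z ∂μ.prod μ, ((Q * R).toPerm z).1 = (S * T).toPerm z.1 := by
  have hq : Measure.QuasiMeasurePreserving Prod.fst (μ.prod μ) μ :=
    Measure.quasiMeasurePreserving_fst
  filter_upwards [MeasAut.toPerm_mul Q R, R.ae_of_ae hQ, hR, hq.ae (MeasAut.toPerm_mul S T)]
    with z h1 h2 h3 h4
  rw [h1, h2, h3, h4]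

theorem fst_pow [SFinite μ] {S : MeasAut μ} {R : MeasAut (μ.prod μ)}
    (hR : ∀ᵐ z ∂μ.prod μ, (R.toPerm z).1 = S.toPerm z.1) (n : ℕ) :
    ∀ᵐ z ∂μ.prod μ, ((R ^ n).toPerm z).1 = (S ^ n).toPerm z.1 := by
  have hq : Measure.QuasiMeasurePreserving Prod.fst (μ.prod μ) μ :=
    Measure.quasiMeasurePreserving_fst
  induction n with
  | zero =>
    filter_upwards [MeasAut.toPerm_one (μ := μ.prod μ), hq.ae (MeasAut.toPerm_one (μ := μ))]
      with z h1 h2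
    rw [pow_zero, pow_zero, h1, h2]
  | succ n ih =>
    rw [pow_succ, pow_succ]
    exact fst_mul ih hR

theorem fst_of_mem_Ext [StandardBorelSpace X] [IsProbabilityMeasure μ] {S : MeasAut μ}
    {R : MeasAut (μ.prod μ)} (hR : R ∈ Ext S) :
    ∀ᵐ z ∂μ.prod μ, (R.toPerm z).1 = S.toPerm z.1 := by
  obtain ⟨T, hT⟩ := hR
  have hm : MeasurableSet {z : X × X | (R.toPerm z).1 = S.toPerm z.1} :=
    measurableSet_eq_fun (measurable_fst.comp R.measurePreserving.measurable)
      (S.measurePreserving.measurable.comp measurable_fst)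
  refine (Measure.ae_prod_iff_ae_ae hm).2 ?_
  filter_upwards [hT.ae_eq] with x hx
  filter_upwards [hx] with y hy
  rw [hy]

open Classical in
/-- Every extension agrees off a small set with a coboundary. -/
theorem exists_coboundary_close [StandardBorelSpace X] [IsProbabilityMeasure μ]
    {S : MeasAut μ} (hS : S.Aperiodic) {P R : MeasAut (μ.prod μ)}
    (hP : ∀ᵐ z ∂μ.prod μ, P.toPerm z = (S.toPerm z.1, z.2)) (hR : R ∈ Ext S)
    (ℰ : DenseFamily (μ.prod μ)) {ε : ℝ} (hε : 0 < ε) :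
    ∃ V : MeasAut (μ.prod μ), (∀ᵐ z ∂μ.prod μ, (V.toPerm z).1 = z.1) ∧
      halmosDist ℰ R (V⁻¹ * P * V) < ε := by
  -- Disagreement on `B × X` costs at most `2 * μ.real B ≤ 2 / (N + 1) < ε`.
  obtain ⟨N, hN⟩ := exists_nat_gt (2 / ε)
  obtain ⟨B, hBm, hB, hhit⟩ := hS.exists_marker N
  have hq : Measure.QuasiMeasurePreserving Prod.fst (μ.prod μ) μ :=
    Measure.quasiMeasurePreserving_fst
  have hfR := fst_of_mem_Ext hR
  have hfP : ∀ᵐ z ∂μ.prod μ, (P.toPerm z).1 = S.toPerm z.1 := hP.mono fun z hz => by rw [hz]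
  -- The second alternative gives the hitting time `k` the value `0` on orbits that miss `B`.
  let p : X → ℕ → Prop := fun x n => S.toPerm^[n] x ∈ B ∨ ∀ j, S.toPerm^[j] x ∉ B
  have hp : ∀ x, ∃ n, p x n := fun x => by
    by_cases h : ∃ n, S.toPerm^[n] x ∈ B
    · exact h.imp fun n hn => Or.inl hn
    · exact ⟨0, Or.inr (not_exists.1 h)⟩
  have hit : ∀ n, MeasurableSet (S.toPerm^[n] ⁻¹' B) := fun n =>
    (S.measurePreserving.measurable.iterate n) hBm
  have hpm : ∀ n, MeasurableSet {x | p x n} := fun n => by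
    have : {x | p x n} = S.toPerm^[n] ⁻¹' B ∪ ⋂ j, (S.toPerm^[j] ⁻¹' B)ᶜ := by
      ext x; simp [p]
    rw [this]
    exact (hit n).union (MeasurableSet.iInter fun j => (hit j).compl)
  let k : X → ℕ := fun x => Nat.find (hp x)
  have hk : Measurable k := measurable_find hp hpm
  have hk_succ : ∀ x, x ∉ B → (∃ n, S.toPerm^[n] x ∈ B) → k x = k (S.toPerm x) + 1 := by
    rintro x hx ⟨n, hn⟩
    have hn' : ∃ n, S.toPerm^[n] (S.toPerm x) ∈ B := by
      cases n with
      | zero => exact absurd hn hx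
      | succ n => exact ⟨n, by rwa [Function.iterate_succ_apply] at hn⟩
    have e1 : ∀ j, p x j ↔ S.toPerm^[j] x ∈ B := fun j =>
      or_iff_left fun h => h n hn
    have e2 : ∀ j, p (S.toPerm x) j ↔ S.toPerm^[j] (S.toPerm x) ∈ B := fun j =>
      or_iff_left fun h => h _ hn'.choose_spec
    rw [Nat.find_eq_iff]
    refine ⟨(e1 _).2 ((e2 _).1 (Nat.find_spec (hp (S.toPerm x)))), fun j hj h => ?_⟩
    cases j with
    | zero => exact hx ((e1 0).1 h)
    | succ j =>
      exact Nat.find_min (hp (S.toPerm x)) (Nat.lt_of_succ_lt_succ hj) ((e2 j).2 ((e1 _).1 h))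
  have hWfst : ∀ n, ∀ᵐ z ∂μ.prod μ, (((P ^ n)⁻¹ * R ^ n).toPerm z).1 = z.1 := fun n => by
    have := fst_mul (fst_inv (fst_pow hfP n)) (fst_pow hfR n)
    rw [inv_mul_cancel] at this
    filter_upwards [this, hq.ae (MeasAut.toPerm_one (μ := μ))] with z h1 h2
    rw [h1, h2]
  obtain ⟨V, hV⟩ := exists_glue (hk.comp measurable_fst) (fun n => (P ^ n)⁻¹ * R ^ n)
    fun n => (hWfst n).mono fun z hz => congrArg k hz
  refine ⟨V, ?_, ?_⟩
  · filter_upwards [hV, ae_all_iff.2 hWfst] with z h1 h2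
    rw [h1, h2]
  · have hclose : ∀ᵐ z ∂μ.prod μ, z ∉ Prod.fst ⁻¹' B →
        R.toPerm z = (V⁻¹ * P * V).toPerm z := by
      -- Off `B` the hitting time drops by one under `S`, so this identity with `n = k (S x)` reads
      -- `P V = V R`.
      have hW1 : ∀ n, ∀ᵐ z ∂μ.prod μ, P.toPerm (((P ^ (n + 1))⁻¹ * R ^ (n + 1)).toPerm z) =
          ((P ^ n)⁻¹ * R ^ n).toPerm (R.toPerm z) := fun n => by
        have e : P * ((P ^ (n + 1))⁻¹ * R ^ (n + 1)) = (P ^ n)⁻¹ * R ^ n * R := by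
          rw [pow_succ, pow_succ]; group
        filter_upwards [MeasAut.toPerm_mul P ((P ^ (n + 1))⁻¹ * R ^ (n + 1)),
          MeasAut.toPerm_mul ((P ^ n)⁻¹ * R ^ n) R] with z h1 h2
        rw [← h1, ← h2, e]
      have hVi : ∀ᵐ z ∂μ.prod μ, (V⁻¹ * P * V).toPerm z =
          V.toPerm.symm (P.toPerm (V.toPerm z)) := by
        filter_upwards [MeasAut.toPerm_mul (V⁻¹ * P) V,
          V.ae_of_ae (MeasAut.toPerm_mul V⁻¹ P), V.ae_of_ae (P.ae_of_ae V.toPerm_inv)]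
          with z h1 h2 h3
        rw [h1, h2, h3]
      filter_upwards [hVi, hV, R.ae_of_ae hV, ae_all_iff.2 hW1, hfR, hq.ae hhit]
        with z h1 h2 h3 h4 h5 h6 hz
      rw [h1, eq_comm, Equiv.symm_apply_eq, h2, h3]
      have e : k z.1 = k (R.toPerm z).1 + 1 := by rw [h5]; exact hk_succ _ hz h6
      simp only [Function.comp_apply, e]
      exact h4 _
    refine lt_of_le_of_lt (halmosDist_le_of_eq_off ℰ _ _ (measurable_fst hBm) hclose) ?_
    rw [measurePreserving_fst.measureReal_preimage hBm.nullMeasurableSet]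
    have hb : 0 ≤ μ.real B := measureReal_nonneg
    rw [div_lt_iff₀ hε] at hN
    have hNp : (0 : ℝ) < (N : ℝ) + 1 := by positivity
    have h1 : μ.real B ≤ 1 / ((N : ℝ) + 1) := by rw [le_div_iff₀ hNp]; linarith
    have h2 : 1 / ((N : ℝ) + 1) < ε / 2 := by rw [div_lt_div_iff₀ hNp two_pos]; nlinarith
    linarith

end Coboundary

/-! ### Coboundaries are recurrent -/

section Recurrence

variable {X : Type*} [MeasurableSpace X] {μ : Measure X}

theorem ae_eq_cocycle [SFinite μ] {S : MeasAut μ} (R : Ext S) (n : ℕ) :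
    ∀ᵐ x ∂μ, ∀ᵐ y ∂μ, (R.1 ^ n).toPerm (x, y) = (S.toPerm^[n] x, (cocycle R x n).toPerm y) := by
  induction n with
  | zero =>
    filter_upwards [Measure.ae_ae_of_ae_prod (MeasAut.toPerm_one (μ := μ.prod μ))] with x hx
    filter_upwards [hx, MeasAut.toPerm_one (μ := μ)] with y h1 h2
    rw [pow_zero, h1, cocycle, h2]
    rfl
  | succ n ih =>
    have hfib := (S.measurePreserving.iterate n).quasiMeasurePreserving.ae R.2.choose_spec.ae_eq
    filter_upwards [ih, hfib, Measure.ae_ae_of_ae_prod (MeasAut.toPerm_mul R.1 (R.1 ^ n))]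
      with x h1 h2 h3
    filter_upwards [h1, (cocycle R x n).ae_of_ae h2, h3, MeasAut.toPerm_mul
      (fiberFamily R (S.toPerm^[n] x)) (cocycle R x n)] with y h4 h5 h6 h7
    rw [pow_succ', h6, h4, h5, cocycle, h7, Function.iterate_succ_apply']
    rfl

/-- The sum `∑ 2⁻ⁱ μ(S⁻¹ Fᵢ ∆ T⁻¹ Fᵢ)` of a sequence of sets. -/
noncomputable def weightedDist (μ : Measure X) (F : ℕ → Set X) (S T : MeasAut μ) : ℝ :=
  ∑' i : ℕ, (1 / 2 : ℝ) ^ i * preimageDist μ (F i) S T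

/-- Preimages under `Q⁻¹` are images under `Q`, which are the sets seen by the weak coordinates. -/
theorem halmosDist_inv_mul_one (𝒜 : DenseFamily μ) (P Q : MeasAut μ) :
    halmosDist 𝒜 (Q⁻¹ * P) 1 = weightedDist μ 𝒜.sets Q⁻¹ P⁻¹ := by
  rw [halmosDist_one]
  refine tsum_congr fun i => ?_
  rw [← preimageDist_mul_right (𝒜.measurable i) Q⁻¹ P⁻¹ P, inv_mul_cancel]

variable [IsProbabilityMeasure μ]

theorem summable_weightedDist (F : ℕ → Set X) (S T : MeasAut μ) :
    Summable fun i : ℕ => (1 / 2 : ℝ) ^ i * preimageDist μ (F i) S T :=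
  Summable.of_nonneg_of_le (fun _ => mul_nonneg (by positivity) (preimageDist_nonneg _ _ _))
    (fun _ => mul_le_of_le_one_right (by positivity) (preimageDist_le_one _ _ _))
    summable_geometric_two

theorem weightedDist_triangle (F : ℕ → Set X) (S T R : MeasAut μ) :
    weightedDist μ F S R ≤ weightedDist μ F S T + weightedDist μ F T R := by
  unfold weightedDist
  rw [← (summable_weightedDist F S T).tsum_add (summable_weightedDist F T R)]
  refine (summable_weightedDist F S R).tsum_le_tsum (fun i => ?_)
    ((summable_weightedDist F S T).add (summable_weightedDist F T R))
  rw [← mul_add]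
  exact mul_le_mul_of_nonneg_left (preimageDist_triangle _ _ _ _) (by positivity)

theorem tendsto_weightedDist {ι : Type*} {l : Filter ι} {F : ℕ → Set X} {u v : ι → MeasAut μ}
    (h : ∀ i, Tendsto (fun a => preimageDist μ (F i) (u a) (v a)) l (nhds 0)) :
    Tendsto (fun a => weightedDist μ F (u a) (v a)) l (nhds 0) := by
  unfold weightedDist
  have := tendsto_tsum_of_dominated_convergence (𝓕 := l) (f := fun a i =>
      (1 / 2 : ℝ) ^ i * preimageDist μ (F i) (u a) (v a)) (g := fun _ => 0)
    summable_geometric_two (fun i => by simpa using (h i).const_mul ((1 / 2 : ℝ) ^ i))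
    (Eventually.of_forall fun a i => by
      rw [Real.norm_of_nonneg (mul_nonneg (by positivity) (preimageDist_nonneg _ _ _))]
      exact mul_le_of_le_one_right (by positivity) (preimageDist_le_one _ _ _))
  rwa [tsum_zero] at this

theorem real_symmDiff_eq {A B : Set X} (hA : MeasurableSet A) (hB : MeasurableSet B) :
    μ.real (A ∆ B) = μ.real A + μ.real B - 2 * μ.real (A ∩ B) := by
  rw [measureReal_symmDiff_eq hA hB]
  have h1 := measureReal_sdiff_add_inter (μ := μ) (s := A) hB
  have h2 := measureReal_sdiff_add_inter (μ := μ) (s := B) hA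
  rw [Set.inter_comm] at h2
  linarith

/-- The weak coordinates `μ(Q Aᵢ ∩ Aⱼ)` of an automorphism. -/
noncomputable def weakCoord (𝒜 : DenseFamily μ) (Q : MeasAut μ) (p : ℕ × ℕ) : ℝ :=
  (μ ((Q.toPerm '' 𝒜.sets p.1) ∩ 𝒜.sets p.2)).toReal

/-- Automorphisms with close weak coordinates are close. -/
theorem tendsto_halmosDist_of_weakCoord (𝒜 : DenseFamily μ) (P : MeasAut μ) :
    Tendsto (fun Q : MeasAut μ => halmosDist 𝒜 (Q⁻¹ * P) 1)
      (comap (weakCoord 𝒜) (nhds (weakCoord 𝒜 P))) (nhds 0) := by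
  have hmeas : ∀ (Q : MeasAut μ) i, MeasurableSet (Q.toPerm '' 𝒜.sets i) := fun Q i => by
    rw [Equiv.image_eq_preimage_symm]
    exact Q.measurePreserving_symm.measurable (𝒜.measurable i)
  have himg : ∀ (Q : MeasAut μ) i, μ.real (Q.toPerm '' 𝒜.sets i) = μ.real (𝒜.sets i) :=
    fun Q i => by
      rw [Equiv.image_eq_preimage_symm]
      exact Q.measurePreserving_symm.measureReal_preimage (𝒜.measurable i).nullMeasurableSet
  have hcoord : ∀ i, Tendsto (fun Q : MeasAut μ => preimageDist μ (𝒜.sets i) Q⁻¹ P⁻¹)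
      (comap (weakCoord 𝒜) (nhds (weakCoord 𝒜 P))) (nhds 0) := by
    intro i
    have hd : ∀ Q : MeasAut μ, preimageDist μ (𝒜.sets i) Q⁻¹ P⁻¹ =
        μ.real ((Q.toPerm '' 𝒜.sets i) ∆ (P.toPerm '' 𝒜.sets i)) := fun Q =>
      (real_symmDiff_congr (image_ae_eq_preimage_inv Q _) (image_ae_eq_preimage_inv P _)).symm
    refine Metric.tendsto_nhds.2 fun ε hε => ?_
    obtain ⟨_, ⟨j, rfl⟩, hj⟩ := 𝒜.dense.approx _ (hmeas P i) (measure_ne_top _ _) (ε / 2)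
      (by positivity)
    have hj' : μ.real ((P.toPerm '' 𝒜.sets i) ∆ 𝒜.sets j) < ε / 2 :=
      (ENNReal.lt_ofReal_iff_toReal_lt (measure_ne_top μ _)).1 hj
    have hc : Tendsto (fun Q : MeasAut μ => μ.real ((Q.toPerm '' 𝒜.sets i) ∆ 𝒜.sets j))
        (comap (weakCoord 𝒜) (nhds (weakCoord 𝒜 P)))
        (nhds (μ.real ((P.toPerm '' 𝒜.sets i) ∆ 𝒜.sets j))) := by
      have h1 : Tendsto (fun Q : MeasAut μ => weakCoord 𝒜 Q (i, j))
          (comap (weakCoord 𝒜) (nhds (weakCoord 𝒜 P))) (nhds (weakCoord 𝒜 P (i, j))) :=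
        (((continuous_apply (i, j)).tendsto (weakCoord 𝒜 P)).comp tendsto_comap :)
      -- Since `Q` preserves `μ`, the distance to a fixed `𝒜.sets j` is affine in one weak
      -- coordinate; `𝒜.sets j` was chosen to approximate the image under `P`.
      have h2 : ∀ Q : MeasAut μ, μ.real ((Q.toPerm '' 𝒜.sets i) ∆ 𝒜.sets j) =
          μ.real (𝒜.sets i) + μ.real (𝒜.sets j) - 2 * weakCoord 𝒜 Q (i, j) := fun Q => by
        rw [real_symmDiff_eq (hmeas Q i) (𝒜.measurable j), himg]
        rfl
      simp only [h2]
      exact (h1.const_mul 2).const_sub _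
    filter_upwards [hc.eventually_lt_const hj'] with Q hQ
    rw [Real.dist_eq, sub_zero, abs_of_nonneg (preimageDist_nonneg _ _ _), hd]
    have := measureReal_symmDiff_le (μ := μ) (s := Q.toPerm '' 𝒜.sets i) (t := 𝒜.sets j)
      (P.toPerm '' 𝒜.sets i)
    rw [symmDiff_comm (𝒜.sets j)] at this
    linarith
  simp only [halmosDist_inv_mul_one]
  exact tendsto_weightedDist hcoord

/-- Coboundaries are recurrent. -/
theorem coboundary_mem_Rec [StandardBorelSpace X] (𝒜 : DenseFamily μ) {S : MeasAut μ} {A : Set X}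
    (hA0 : 0 < μ A) {P V : MeasAut (μ.prod μ)}
    (hP : ∀ᵐ z ∂μ.prod μ, P.toPerm z = (S.toPerm z.1, z.2))
    (hV : ∀ᵐ z ∂μ.prod μ, (V.toPerm z).1 = z.1) (hR : V⁻¹ * P * V ∈ Ext S) :
    (⟨V⁻¹ * P * V, hR⟩ : Ext S) ∈ Rec 𝒜 S A := by
  have hq : Measure.QuasiMeasurePreserving Prod.fst (μ.prod μ) μ :=
    Measure.quasiMeasurePreserving_fst
  obtain ⟨T, hT⟩ : V ∈ Ext (1 : MeasAut μ) := mem_Ext_of_fst (by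
    filter_upwards [hV, hq.ae (MeasAut.toPerm_one (μ := μ))] with z h1 h2
    rw [h1, h2])
  have hTe : ∀ᵐ x ∂μ, ∀ᵐ y ∂μ, V.toPerm (x, y) = (x, (T x).toPerm y) := by
    filter_upwards [hT.ae_eq, MeasAut.toPerm_one (μ := μ)] with x h1 h2
    rwa [h2] at h1
  have hPn : ∀ n : ℕ, ∀ᵐ z ∂μ.prod μ, (P ^ n).toPerm z = (S.toPerm^[n] z.1, z.2) := by
    intro n
    induction n with
    | zero => simpa using MeasAut.toPerm_one (μ := μ.prod μ)
    | succ n ih =>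
      filter_upwards [MeasAut.toPerm_mul (P ^ n) P, P.ae_of_ae ih, hP] with z h1 h2 h3
      rw [pow_succ, h1, h2, h3, Function.iterate_succ_apply]
  set R : Ext S := ⟨V⁻¹ * P * V, hR⟩ with hRdef
  have hcoc : ∀ n : ℕ, ∀ᵐ x ∂μ, cocycle R x n = (T (S.toPerm^[n] x))⁻¹ * T x := by
    intro n
    -- Comparing second coordinates, with `P ^ n` trivial on fibres, gives `T (Sⁿx) * cocycle = T
    -- x`.
    have e : V * R.1 ^ n = P ^ n * V := by
      have : R.1 = V⁻¹ * P * (V⁻¹)⁻¹ := by rw [inv_inv]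
      rw [this, conj_pow]; group
    have e1 := MeasAut.toPerm_mul V (R.1 ^ n)
    have e2 := MeasAut.toPerm_mul (P ^ n) V
    rw [e] at e1
    filter_upwards [Measure.ae_ae_of_ae_prod e1, Measure.ae_ae_of_ae_prod e2, ae_eq_cocycle R n,
      hTe, (S.measurePreserving.iterate n).quasiMeasurePreserving.ae hTe,
      Measure.ae_ae_of_ae_prod (V.ae_of_ae (hPn n))] with x h1 h2 h3 h4 h5 h6
    rw [eq_inv_mul_iff_mul_eq]
    refine MeasAut.ext_ae ?_
    filter_upwards [h1, h2, h3, h4, (cocycle R x n).ae_of_ae h5, h6, MeasAut.toPerm_mul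
      (T (S.toPerm^[n] x)) (cocycle R x n)] with y g1 g2 g3 g4 g5 g6 g7
    rw [g7]
    rw [g1, g3, g5, g6, g4] at g2
    exact (Prod.ext_iff.1 g2).2
  have hFm : Measurable fun x => weakCoord 𝒜 (T x) :=
    measurable_pi_lambda _ fun p =>
      (hT.measurable _ _ (𝒜.measurable p.1) (𝒜.measurable p.2)).ennreal_toReal
  have hrec : ∀ᵐ x ∂μ, ∀ ε > 0, ∃ᶠ n in atTop,
      halmosDist 𝒜 ((T (S.toPerm^[n] x))⁻¹ * T x) 1 < ε := by
    -- This topology is second countable with measurable open sets, as Poincaré recurrence requires;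
    -- nearness to `x` in it means nearness of the fibre automorphisms.
    let τ : TopologicalSpace X := TopologicalSpace.induced (fun x => weakCoord 𝒜 (T x)) inferInstance
    have h2 : SecondCountableTopology X :=
      TopologicalSpace.secondCountableTopology_induced X (ℕ × ℕ → ℝ) _
    have h3 : OpensMeasurableSpace X := ⟨by
      refine MeasurableSpace.generateFrom_le fun U hU => ?_
      obtain ⟨W, hW, rfl⟩ := isOpen_induced_iff.1 hU
      exact hFm hW.measurableSet⟩
    filter_upwards [S.measurePreserving.conservative.ae_frequently_mem_of_mem_nhds] with x hx ε hε
    have ht : Tendsto (fun z => halmosDist 𝒜 ((T z)⁻¹ * T x) 1) (nhds x) (nhds 0) := by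
      refine (tendsto_halmosDist_of_weakCoord 𝒜 (T x)).comp ?_
      rw [tendsto_comap_iff, nhds_induced]
      exact tendsto_comap
    exact hx _ (ht.eventually_lt_const hε)
  intro m N hm
  by_contra! hcon
  have hnull : ∀ᵐ x ∂μ, ∀ n, N < n → x ∉ returnSet 𝒜 m n R A :=
    ae_all_iff.2 fun n => by
      by_cases hn : N < n
      · filter_upwards [measure_eq_zero_iff_ae_notMem.1 (le_antisymm (hcon n hn) bot_le)]
          with x hx _ using hx
      · exact Eventually.of_forall fun x h => absurd h hn
  have : ∀ᵐ x ∂μ, x ∉ A := by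
    filter_upwards [hnull, hrec, ae_all_iff.2 hcoc] with x h1 h2 h3 hxA
    obtain ⟨n, hlt, hn⟩ := ((h2 (1 / (m : ℝ)) (by positivity)).and_eventually
      (eventually_gt_atTop N)).exists
    exact h1 n hn ⟨hxA, by rwa [h3 n]⟩
  exact hA0.ne' (measure_eq_zero_iff_ae_notMem.2 this)

end Recurrence

/-! ### Openness of the return conditions -/

section Openness

variable {X : Type*} [MeasurableSpace X] {μ : Measure X}

theorem preimageDist_mul_left (E : Set X) (S T R : MeasAut μ) :
    preimageDist μ E (S * T) (S * R) = preimageDist μ (S.toPerm ⁻¹' E) T R :=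
  real_symmDiff_congr (preimage_ae_congr (MeasAut.toPerm_mul S T) E)
    (preimage_ae_congr (MeasAut.toPerm_mul S R) E)

theorem halmosDist_one_eq_weightedDist (𝒜 : DenseFamily μ) (S : MeasAut μ) :
    halmosDist 𝒜 S 1 = weightedDist μ 𝒜.sets S 1 :=
  halmosDist_one 𝒜 S

variable [IsProbabilityMeasure μ]

theorem preimageDist_le_add {E F : Set X} (hE : MeasurableSet E) (hF : MeasurableSet F)
    (S T : MeasAut μ) :
    preimageDist μ E S T ≤ preimageDist μ F S T + 2 * μ.real (E ∆ F) := by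
  have h : ∀ R : MeasAut μ, μ.real ((R.toPerm ⁻¹' E) ∆ (R.toPerm ⁻¹' F)) = μ.real (E ∆ F) :=
    fun R => by
      rw [← Set.preimage_symmDiff]
      exact R.measurePreserving.measureReal_preimage (hE.symmDiff hF).nullMeasurableSet
  have t1 := measureReal_symmDiff_le (μ := μ) (s := S.toPerm ⁻¹' E) (t := S.toPerm ⁻¹' F)
    (T.toPerm ⁻¹' E)
  have t2 := measureReal_symmDiff_le (μ := μ) (s := S.toPerm ⁻¹' F) (t := T.toPerm ⁻¹' F)
    (T.toPerm ⁻¹' E)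
  rw [h] at t1
  rw [symmDiff_comm (T.toPerm ⁻¹' F), h] at t2
  unfold preimageDist
  linarith

/-- Halmos convergence controls the sets of the dense family, hence by approximation every
measurable set, in particular the cylinders `Prod.snd ⁻¹' F`. -/
theorem tendsto_preimageDist (ℰ : DenseFamily μ) {R : MeasAut μ} {ι : Type*} {l : Filter ι}
    {u : ι → MeasAut μ} (hu : Tendsto (fun a => halmosDist ℰ (u a) R) l (nhds 0)) {E : Set X}
    (hE : MeasurableSet E) : Tendsto (fun a => preimageDist μ E (u a) R) l (nhds 0) := by
  refine Metric.tendsto_nhds.2 fun ε hε => ?_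
  obtain ⟨_, ⟨j, rfl⟩, hj⟩ := ℰ.dense.approx E hE (measure_ne_top _ _) (ε / 4) (by positivity)
  have hj' : μ.real (E ∆ ℰ.sets j) < ε / 4 :=
    (ENNReal.lt_ofReal_iff_toReal_lt (measure_ne_top μ _)).1 hj
  have h := (hu.const_mul (2 ^ (j + 1))).eventually_lt_const
    (show (2 : ℝ) ^ (j + 1) * 0 < ε / 2 by rw [mul_zero]; positivity)
  filter_upwards [h] with a ha
  rw [Real.dist_eq, sub_zero, abs_of_nonneg (preimageDist_nonneg _ _ _)]
  have h1 := preimageDist_le_add hE (ℰ.measurable j) (u a) R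
  have h2 := preimageDist_le_halmosDist ℰ (u a) R j
  linarith

theorem tendsto_preimageDist_pow (ℰ : DenseFamily μ) {R : MeasAut μ} {ι : Type*} {l : Filter ι}
    {u : ι → MeasAut μ} (hu : Tendsto (fun a => halmosDist ℰ (u a) R) l (nhds 0)) (n : ℕ)
    {E : Set X} (hE : MeasurableSet E) :
    Tendsto (fun a => preimageDist μ E (u a ^ n) (R ^ n)) l (nhds 0) := by
  induction n with
  | zero => simpa [preimageDist] using tendsto_const_nhds
  | succ n ih =>
    have h2 := tendsto_preimageDist ℰ hu ((R ^ n).measurePreserving.measurable hE)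
    refine squeeze_zero (fun a => preimageDist_nonneg _ _ _) (fun a => ?_)
      (by simpa using ih.add h2)
    -- The intermediate term is `R ^ n * u a`: one step changes the `n`-th power, the other the last
    -- factor.
    rw [pow_succ, pow_succ, ← preimageDist_mul_left,
      ← preimageDist_mul_right hE (u a ^ n) (R ^ n) (u a)]
    exact preimageDist_triangle _ _ _ _

/-- The cocycles of two extensions are close in measure if the iterates are close. -/
theorem measure_weightedDist_cocycle_ge {S : MeasAut μ} {F : ℕ → Set X}
    (hF : ∀ i, MeasurableSet (F i)) (Q R : Ext S) (n : ℕ) {δ : ℝ} (hδ : 0 < δ) :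
    μ {x | δ ≤ weightedDist μ F (cocycle Q x n) (cocycle R x n)} ≤
      ENNReal.ofReal (weightedDist (μ.prod μ) (fun i => Prod.snd ⁻¹' F i) (Q.1 ^ n) (R.1 ^ n)) /
        ENNReal.ofReal δ := by
  let G : ℕ → Set (X × X) := fun i =>
    ((Q.1 ^ n).toPerm ⁻¹' (Prod.snd ⁻¹' F i)) ∆ ((R.1 ^ n).toPerm ⁻¹' (Prod.snd ⁻¹' F i))
  have hG : ∀ i, MeasurableSet (G i) := fun i =>
    ((Q.1 ^ n).measurePreserving.measurable (measurable_snd (hF i))).symmDiff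
      ((R.1 ^ n).measurePreserving.measurable (measurable_snd (hF i)))
  -- A measurable version of the fibrewise distance of the cocycles. Its integral is the distance of
  -- the iterates, and Markov's inequality finishes.
  let Φ : X → ENNReal := fun x => ∑' i, ENNReal.ofReal ((1 / 2) ^ i) * μ (Prod.mk x ⁻¹' G i)
  have hΦm : Measurable Φ := Measurable.tsum fun i =>
    (measurable_measure_prodMk_left (hG i)).const_mul _
  have hΦ : ∀ᵐ x ∂μ,
      Φ x = ENNReal.ofReal (weightedDist μ F (cocycle Q x n) (cocycle R x n)) := by
    filter_upwards [ae_eq_cocycle Q n, ae_eq_cocycle R n] with x h1 h2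
    unfold weightedDist
    rw [ENNReal.ofReal_tsum_of_nonneg
      (fun i => mul_nonneg (by positivity) (preimageDist_nonneg _ _ _))
      (summable_weightedDist F _ _)]
    refine tsum_congr fun i => ?_
    rw [ENNReal.ofReal_mul (by positivity), preimageDist, ofReal_measureReal]
    congr 1
    refine measure_congr ?_
    filter_upwards [h1, h2] with y g1 g2
    refine propext ?_
    change ((_ ∈ F i ∧ ¬ _ ∈ F i) ∨ (_ ∈ F i ∧ ¬ _ ∈ F i)) ↔
      ((_ ∈ F i ∧ ¬ _ ∈ F i) ∨ (_ ∈ F i ∧ ¬ _ ∈ F i))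
    rw [g1, g2]
  have hint : ∫⁻ x, Φ x ∂μ = ENNReal.ofReal
      (weightedDist (μ.prod μ) (fun i => Prod.snd ⁻¹' F i) (Q.1 ^ n) (R.1 ^ n)) := by
    unfold weightedDist
    rw [ENNReal.ofReal_tsum_of_nonneg
      (fun i => mul_nonneg (by positivity) (preimageDist_nonneg _ _ _))
      (summable_weightedDist (fun i => Prod.snd ⁻¹' F i) _ _), lintegral_tsum fun i =>
        ((measurable_measure_prodMk_left (hG i)).const_mul _).aemeasurable]
    refine tsum_congr fun i => ?_
    rw [lintegral_const_mul _ (measurable_measure_prodMk_left (hG i)),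
      ← Measure.prod_apply (hG i), ENNReal.ofReal_mul (by positivity), preimageDist,
      ofReal_measureReal]
  rw [← hint]
  refine le_trans (measure_mono_ae ?_)
    (meas_ge_le_lintegral_div hΦm.aemeasurable (ENNReal.ofReal_pos.2 hδ).ne' ENNReal.ofReal_ne_top)
  filter_upwards [hΦ] with x hx hxs
  change ENNReal.ofReal δ ≤ Φ x
  rw [hx]
  exact ENNReal.ofReal_le_ofReal hxs

/-- Recurrence at a given time is an open condition. -/
theorem eventually_returnSet_pos (𝒜 : DenseFamily μ) (ℰ : DenseFamily (μ.prod μ)) {S : MeasAut μ}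
    {A : Set X} {m n : ℕ} {R : Ext S} (hR : 0 < μ (returnSet 𝒜 m n R A)) {l : Filter (Ext S)}
    (hl : Tendsto (fun Q : Ext S => halmosDist ℰ Q.1 R.1) l (nhds 0)) :
    ∀ᶠ Q in l, 0 < μ (returnSet 𝒜 m n Q A) := by
  -- Return points with slack `1 / (j + 1)`. They exhaust the return set, so one `E j` has positive
  -- measure.
  let E : ℕ → Set X := fun j =>
    {x | x ∈ A ∧ halmosDist 𝒜 (cocycle R x n) 1 < 1 / (m : ℝ) - 1 / ((j : ℝ) + 1)}
  obtain ⟨j, hj⟩ : ∃ j, 0 < μ (E j) := by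
    by_contra! h
    refine hR.ne' (measure_mono_null ?_ (measure_iUnion_null fun j => le_antisymm (h j) bot_le))
    rintro x ⟨hxA, hx⟩
    obtain ⟨j, hj⟩ := exists_nat_one_div_lt (sub_pos.2 hx)
    exact Set.mem_iUnion.2 ⟨j, hxA, by linarith⟩
  set δ : ℝ := 1 / ((j : ℝ) + 1) with hδ_def
  have hδ : 0 < δ := by positivity
  have ht : Tendsto (fun Q : Ext S => ENNReal.ofReal (weightedDist (μ.prod μ)
      (fun i => Prod.snd ⁻¹' 𝒜.sets i) (Q.1 ^ n) (R.1 ^ n)) / ENNReal.ofReal δ) l (nhds 0) := by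
    have h1 := tendsto_weightedDist (F := fun i => Prod.snd ⁻¹' 𝒜.sets i)
      fun i => tendsto_preimageDist_pow ℰ hl n (measurable_snd (𝒜.measurable i))
    have h2 := ENNReal.Tendsto.div_const (ENNReal.tendsto_ofReal h1)
      (b := ENNReal.ofReal δ) (Or.inr (ENNReal.ofReal_pos.2 hδ).ne')
    simpa using h2
  filter_upwards [ht.eventually_lt_const hj] with Q hQ
  have hlt := (measure_weightedDist_cocycle_ge 𝒜.measurable Q R n hδ).trans_lt hQ
  by_contra! h0
  -- A point of `E j` whose cocycle moves by less than the slack is still a return point for `Q`; a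
  -- null return set would force `E j` into the bad set, whose measure is smaller.
  refine hlt.not_ge (le_trans (measure_mono (t := returnSet 𝒜 m n Q A ∪
    {x | δ ≤ weightedDist μ 𝒜.sets (cocycle Q x n) (cocycle R x n)}) ?_)
    ((measure_union_le _ _).trans (by rw [le_antisymm h0 bot_le, zero_add])))
  rintro x ⟨hxA, hx⟩
  by_cases hx' : δ ≤ weightedDist μ 𝒜.sets (cocycle Q x n) (cocycle R x n)
  · exact Or.inr hx'
  · refine Or.inl ⟨hxA, ?_⟩
    have := weightedDist_triangle 𝒜.sets (cocycle Q x n) (cocycle R x n) 1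
    rw [halmosDist_one_eq_weightedDist] at hx ⊢
    linarith [not_le.1 hx']

end Openness

end SkewRec

theorem mainTheorem2 {X : Type*} [MeasurableSpace X] [StandardBorelSpace X]
    (μ : MeasureTheory.Measure X) [MeasureTheory.IsProbabilityMeasure μ]
    (𝒜 : SkewRec.DenseFamily μ) (ℰ : SkewRec.DenseFamily (μ.prod μ))
    (S : SkewRec.MeasAut μ) (hS : S.Aperiodic)
    (A : Set X) (hA : MeasurableSet A) (hA0 : 0 < μ A) :
    letI : MetricSpace (SkewRec.MeasAut (μ.prod μ)) := SkewRec.halmosMetricSpace ℰ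
    ∃ G : Set (SkewRec.Ext S), IsGδ G ∧ Dense G ∧ G ⊆ SkewRec.Rec 𝒜 S A := by
  let : MetricSpace (SkewRec.MeasAut (μ.prod μ)) := SkewRec.halmosMetricSpace ℰ
  refine ⟨SkewRec.Rec 𝒜 S A, ?_, ?_, subset_rfl⟩
  · have e : SkewRec.Rec 𝒜 S A = ⋂ p : ℕ × ℕ, {R | 1 ≤ p.1 → ∃ n : ℕ, p.2 < n ∧
        0 < μ (SkewRec.returnSet 𝒜 p.1 n R A)} := by
      ext R
      simp only [Set.mem_iInter, Prod.forall]
      exact forall_congr' fun m => forall_congr' fun N => Iff.rfl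
    rw [e]
    refine IsGδ.iInter fun p => IsOpen.isGδ (isOpen_iff_mem_nhds.2 fun R hR => ?_)
    by_cases hm : 1 ≤ p.1
    · obtain ⟨n, hn, hpos⟩ := hR hm
      have hl : Tendsto (fun Q : SkewRec.Ext S => dist Q.1 R.1) (nhds R) (nhds 0) := by
        have := (continuous_subtype_val.tendsto R).dist (tendsto_const_nhds (x := R.1))
        rwa [dist_self] at this
      filter_upwards [SkewRec.eventually_returnSet_pos 𝒜 ℰ hpos hl] with Q hQ _
      exact ⟨n, hn, hQ⟩
    · exact Filter.univ_mem' fun Q h => absurd h hm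
  · refine Metric.dense_iff.2 fun R ε hε => ?_
    obtain ⟨P, hP⟩ := SkewRec.exists_prod_one S
    obtain ⟨V, hV, hlt⟩ := SkewRec.exists_coboundary_close hS hP R.2 ℰ hε
    have hfV : ∀ᵐ z ∂μ.prod μ, (V.toPerm z).1 = (1 : SkewRec.MeasAut μ).toPerm z.1 := by
      filter_upwards [hV, Measure.quasiMeasurePreserving_fst.ae
        (SkewRec.MeasAut.toPerm_one (μ := μ))] with z h1 h2
      rw [h1, h2]
    have hfP : ∀ᵐ z ∂μ.prod μ, (P.toPerm z).1 = S.toPerm z.1 := hP.mono fun z hz => by rw [hz]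
    have hmem : V⁻¹ * P * V ∈ SkewRec.Ext S := SkewRec.mem_Ext_of_fst (by
      have := SkewRec.fst_mul (SkewRec.fst_mul (SkewRec.fst_inv hfV) hfP) hfV
      rwa [inv_one, one_mul, mul_one] at this)
    refine ⟨⟨V⁻¹ * P * V, hmem⟩, ?_, SkewRec.coboundary_mem_Rec 𝒜 hA0 hP hV hmem⟩
    rw [Metric.mem_ball, dist_comm]
    exact hlt
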